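/- \textbf{Setting.} Let $L\ge 1$, let $p_0=d,p_1,\dots,p_L$ be layer widths and $p_{L+1}=1$. For a tuple $\Theta=(W^L,\dots,W^0)$ of weight matrices $W^l\in\mathbb{R}^{p_{l+1}\times p_l}$ (the parameter space $\mathcal A$) and activation functions $f^l:\mathbb{R}^{p_l}\to\mathbb{R}^{p_l}$, $1\le l\le L$, let $$g_\Theta[x]=W^L f^L\big[\cdots W^1 f^1[W^0x]\big]\in\mathbb{R},\qquad x\in\mathbb{R}^d,\qquad P=\sum_{l=0}^{L}p_{l+1}p_l .$$ The activations satisfy $f^l[0]=0$, are $a_{\mathrm{Lip}}$-Lipschitz for the Euclidean norms ($a_{\mathrm{Lip}}\ge 0$), and satisfy $f^l[sz]=s f^l[z]$ for all $s\ge 0$. The data are $y_i=g[x_i]+u_i$, $i=1,\dots,n$, with an arbitrary function $g:\mathbb{R}^d\to\mathbb{R}$, deterministic $x_i\in\mathbb{R}^d$, and independent centered noise variables $u_i$ with $K^2(\mathbb{E}e^{|u_i|^2/K^2}-1)\le\gamma^2$ for all $i$, where $K,\gamma\in(0,\infty)$. Put $\|x\|_n=\sqrt{\sum_{i=1}^n\|x_i\|_2^2/n}$.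 Let $G=(G^L,\dots,G^0)$ be matrices, $G^l$ with $p_{l+1}$ columns and any number of rows, and put $G\Theta=(G^lW^l)_l$ and $\Pi_G\Theta=(\Pi_{\ker G^l}W^l)_l$, where $\Pi_{\ker G^l}$ is the orthogonal projection onto $\ker G^l$, applied to each column. Let $\|\cdot\|_1$ be the sum of the absolute values of all entries, let $\bar G^l:\ker(G^l)^\perp\to\operatorname{Im}(G^l)$ be the invertible map induced by $G^l$, and let $$M_G=\max_l\big\|(\bar G^{l})^{-1}\big\|_{1\to1},\qquad \|(\bar G^{l})^{-1}\|_{1\to 1}=\sup_{0\ne z\in\operatorname{Im}(G^l)}\frac{\|(\bar G^{l})^{-1}z\|_1}{\|z\|_1}\quad(=0\text{ if }G^l=0).$$ For $\nu>0$ let $\mathfrak h[\Theta]=\|G\Theta\|_1+\nu\|\Pi_G\Theta\|_1$ and $\mathcal A_{\mathfrak h}=\{\Theta\in\mathcal A:\mathfrak h[\Theta]\le1\}$. For $\lambda\ge 0$ consider the estimators $$(\hat\kappa,\hat\Omega)\in\operatorname*{arg\,min}_{\kappa\ge0,\ \Omega\in\mathcal A_{\mathfrak h}}\Big\{\frac1n\sum_{i=1}^n\big(y_i-\kappa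 g_\Omega[x_i]\big)^2+\lambda\kappa\Big\},$$ and let $\mathrm{err}(\kappa g_\Omega)=\sqrt{\frac1n\sum_{i=1}^n(g[x_i]-\kappa g_\Omega[x_i])^2}$. \textbf{Theorem (Prediction guarantee for deep learning).} For all $K,\gamma\in(0,\infty)$ there is a constant $C\in(0,\infty)$, depending only on $K$ and $\gamma$, and for all $L\ge1$, $a_{\mathrm{Lip}}\ge0$ and $r>0$ there is an $N$, depending only on $K,\gamma,L,a_{\mathrm{Lip}},r$ (and not on the widths, the activations, $G$, $\nu$, $\lambda$, $g$, the $x_i$ or the law of the noise), such that the following holds in the above setting for all $n\ge N$. If $\|x\|_n\ge r$, $M_G<1$, $\nu\ge 1/(1-M_G)$ and $$\lambda\ \ge\ C\,(M_G+1)\,a_{\mathrm{Lip}}^{2L}\,\|x\|_n^2\Big(\frac{\sqrt2}{L}\Big)^{2L-1}\sqrt{\log(2P)}\;\frac{\log(2n)}{\sqrt n},$$ then there is an event of probability at least $1-1/n$ on which every such estimator satisfies $$\mathrm{err}^2(\hat\kappa g_{\hat\Omega})\ \le\ \inf_{\kappa\ge0,\ \Omega\in\mathcal A_{\mathfrak h}}\big\{\mathrm{err}^2(\kappa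 g_\Omega)+2\lambda\kappa\big\}.$$ -/

import Mathlib

open MeasureTheory ProbabilityTheory

noncomputable section

namespace DeepNet

/-- Layer widths of a feed-forward network with `L` hidden layers, input dimension `p 0` and
output dimension `p (L + 1) = 1`. Only the values `p 0, …, p (L + 1)` are ever used. -/
structure Architecture (L : ℕ) where
  p : ℕ → ℕ
  p_out : p (L + 1) = 1

variable {L : ℕ}

/-- The parameter space: tuples of weight matrices `W l ∈ ℝ ^ (p (l + 1) × p l)`, `0 ≤ l ≤ L`. -/
abbrev Params (A : Architecture L) : Type :=
  (l : Fin (L + 1)) → Matrix (Fin (A.p (l + 1))) (Fin (A.p l)) ℝ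

/-- Activation functions; only `f 1, …, f L` enter the network, `f l` acts on `ℝ ^ (p l)`. -/
abbrev Activations (A : Architecture L) : Type :=
  (l : ℕ) → EuclideanSpace ℝ (Fin (A.p l)) → EuclideanSpace ℝ (Fin (A.p l))

/-- The total number of parameters `P = ∑ l, p (l + 1) * p l`. -/
def numParams (A : Architecture L) : ℕ := ∑ l : Fin (L + 1), A.p (l + 1) * A.p l

/-- The activations vanish at zero, are `a`-Lipschitz for the Euclidean norms, and are
non-negative homogeneous of degree one. -/
structure IsAdmissible (A : Architecture L) (f : Activations A) (a : ℝ) : Prop where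
  map_zero : ∀ l, 1 ≤ l → l ≤ L → f l 0 = 0
  lipschitz : ∀ l, 1 ≤ l → l ≤ L → ∀ z z', ‖f l z - f l z'‖ ≤ a * ‖z - z'‖
  homogeneous : ∀ l, 1 ≤ l → l ≤ L → ∀ s : ℝ, 0 ≤ s → ∀ z, f l (s • z) = s • f l z

/-- `layer A f Θ x l = W l (f l (W (l - 1) (… f 1 (W 0 x))))`. -/
def layer (A : Architecture L) (f : Activations A) (Θ : Params A)
    (x : EuclideanSpace ℝ (Fin (A.p 0))) :
    (l : ℕ) → l < L + 1 → EuclideanSpace ℝ (Fin (A.p (l + 1)))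
  | 0, h => WithLp.toLp 2 ((Θ ⟨0, h⟩).mulVec x.ofLp)
  | l + 1, h => WithLp.toLp 2
      ((Θ ⟨l + 1, h⟩).mulVec (f (l + 1) (layer A f Θ x l (Nat.lt_of_succ_lt h))).ofLp)

/-- The network `g_Θ[x] = W L f L [… W 1 f 1 [W 0 x]]`, a real number as `p (L + 1) = 1`. -/
def network (A : Architecture L) (f : Activations A) (Θ : Params A)
    (x : EuclideanSpace ℝ (Fin (A.p 0))) : ℝ :=
  layer A f Θ x L (Nat.lt_succ_self L) ⟨0, by rw [A.p_out]; exact Nat.one_pos⟩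

/-- The entrywise `ℓ¹` norm of a matrix. -/
def l1Norm {m n : ℕ} (W : Matrix (Fin m) (Fin n) ℝ) : ℝ := ∑ k, ∑ j, |W k j|

/-- The `ℓ¹` norm of a vector. -/
def vecL1 {m : ℕ} (v : EuclideanSpace ℝ (Fin m)) : ℝ := ∑ k, |v k|

/-- The kernel of a matrix, as a subspace of Euclidean space. -/
def kernel {m n : ℕ} (G : Matrix (Fin m) (Fin n) ℝ) :
    Submodule ℝ (EuclideanSpace ℝ (Fin n)) :=
  LinearMap.ker (Matrix.toEuclideanLin G)

/-- The orthogonal projection of `W` onto `{V | G V = 0}`: every column is projected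
orthogonally onto the kernel of `G`. -/
def projKer {m n q : ℕ} (G : Matrix (Fin m) (Fin n) ℝ) (W : Matrix (Fin n) (Fin q) ℝ) :
    Matrix (Fin n) (Fin q) ℝ :=
  Matrix.of fun k c => (kernel G).starProjection (WithLp.toLp 2 fun i => W i c) k

/-- The isomorphism `ker(G)ᗮ ≃ Im(G)` obtained by restricting `G`. -/
def inducedEquiv {m n : ℕ} (G : Matrix (Fin m) (Fin n) ℝ) :
    (kernel G)ᗮ ≃ₗ[ℝ] LinearMap.range (Matrix.toEuclideanLin G) :=
  (Matrix.toEuclideanLin G).kerComplementEquivRange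
    (Submodule.isCompl_orthogonal (K := kernel G)).symm

/-- The operator norm `1 → 1` of the inverse `Im(G) → ker(G)ᗮ` of the map induced by `G`; it is
zero when `G = 0`. -/
def invNorm {m n : ℕ} (G : Matrix (Fin m) (Fin n) ℝ) : ℝ :=
  ⨆ y : LinearMap.range (Matrix.toEuclideanLin G),
    vecL1 ((inducedEquiv G).symm y : EuclideanSpace ℝ (Fin n)) /
      vecL1 (y : EuclideanSpace ℝ (Fin m))

/-- A tuple `G = (G L, …, G 0)`; `G l` multiplies the weight matrix `W l` from the left and has
`m l` rows. -/
abbrev RegMatrices (A : Architecture L) (m : Fin (L + 1) → ℕ) : Type :=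
  (l : Fin (L + 1)) → Matrix (Fin (m l)) (Fin (A.p (l + 1))) ℝ

/-- `M_G`, the largest of the norms `invNorm (G l)`. -/
def constM (A : Architecture L) {m : Fin (L + 1) → ℕ} (G : RegMatrices A m) : ℝ :=
  ⨆ l, invNorm (G l)

/-- The regularizer `h[Θ] = ‖G Θ‖₁ + ν ‖Π_G Θ‖₁`. -/
def reg (A : Architecture L) {m : Fin (L + 1) → ℕ} (G : RegMatrices A m) (ν : ℝ)
    (Θ : Params A) : ℝ :=
  ∑ l, l1Norm (G l * Θ l) + ν * ∑ l, l1Norm (projKer (G l) (Θ l))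

/-- The unit ball `{Θ | h[Θ] ≤ 1}` of the regularizer. -/
def unitBall (A : Architecture L) {m : Fin (L + 1) → ℕ} (G : RegMatrices A m) (ν : ℝ) :
    Set (Params A) :=
  {Θ | reg A G ν Θ ≤ 1}

/-- `‖x‖_n = √(∑ i, ‖x i‖² / n)`. -/
def empNorm {d n : ℕ} (x : Fin n → EuclideanSpace ℝ (Fin d)) : ℝ :=
  √(∑ i, ‖x i‖ ^ 2 / n)

/-- The prediction error of `κ g_Θ` for the data-generating function `g`. -/
def err (A : Architecture L) (f : Activations A) {n : ℕ}
    (x : Fin n → EuclideanSpace ℝ (Fin (A.p 0))) (g : EuclideanSpace ℝ (Fin (A.p 0)) → ℝ)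
    (κ : ℝ) (Θ : Params A) : ℝ :=
  √(1 / n * ∑ i, (g (x i) - κ * network A f Θ (x i)) ^ 2)

/-- The penalized least-squares objective. -/
def objective (A : Architecture L) (f : Activations A) {n : ℕ}
    (x : Fin n → EuclideanSpace ℝ (Fin (A.p 0))) (y : Fin n → ℝ) (lam : ℝ)
    (q : ℝ × Params A) : ℝ :=
  1 / n * ∑ i, (y i - q.1 * network A f q.2 (x i)) ^ 2 + lam * q.1

/-- `(κ, Θ)` minimizes the objective over `[0, ∞) × {h ≤ 1}`. -/
def IsEstimator (A : Architecture L) (f : Activations A) {m : Fin (L + 1) → ℕ}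
    (G : RegMatrices A m) (ν : ℝ) {n : ℕ} (x : Fin n → EuclideanSpace ℝ (Fin (A.p 0)))
    (y : Fin n → ℝ) (lam : ℝ) (q : ℝ × Params A) : Prop :=
  q ∈ Set.Ici (0 : ℝ) ×ˢ unitBall A G ν ∧
    IsMinOn (objective A f x y lam) (Set.Ici (0 : ℝ) ×ˢ unitBall A G ν) q

/-- Independent, centered and uniformly sub-Gaussian noise with constants `K` and `γ`. -/
structure IsSubGaussianNoise {Ω : Type*} [MeasurableSpace Ω] (μ : Measure Ω) {n : ℕ}
    (u : Fin n → Ω → ℝ) (K γ : ℝ) : Prop where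
  measurable : ∀ i, Measurable (u i)
  indep : iIndepFun u μ
  integrable : ∀ i, Integrable (u i) μ
  centered : ∀ i, ∫ ω, u i ω ∂μ = 0
  integrable_exp : ∀ i, Integrable (fun ω => Real.exp (|u i ω| ^ 2 / K ^ 2)) μ
  subGaussian : ∀ i, K ^ 2 * (∫ ω, Real.exp (|u i ω| ^ 2 / K ^ 2) ∂μ - 1) ≤ γ ^ 2

end DeepNet

end

noncomputable section

namespace DeepNet

lemma exp_le_add_exp_sq (x : ℝ) : Real.exp x ≤ x + Real.exp (x ^ 2) := by
  have hsq := Real.add_one_le_exp (x ^ 2)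
  rcases le_or_gt |x| 1 with h | h
  · have := (abs_le.1 (Real.abs_exp_sub_one_sub_id_le h)).2
    linarith
  · rcases lt_abs.1 h with h | h
    · have : Real.exp x ≤ Real.exp (x ^ 2) := Real.exp_le_exp.2 (by nlinarith)
      linarith
    · have : Real.exp x ≤ 1 := Real.exp_le_one_iff.2 (by linarith)
      nlinarith

lemma exp_mul_le_one_add {s : ℝ} (hs : 0 ≤ s) (hs1 : s ≤ 1) (v : ℝ) :
    Real.exp (s * v) ≤ 1 + s * (Real.exp v - 1) := by
  have := convexOn_exp.2 (Set.mem_univ 0) (Set.mem_univ v) (sub_nonneg.2 hs1) hs (by ring)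
  simp only [smul_eq_mul, mul_zero, zero_add, Real.exp_zero, mul_one] at this
  linarith

section Noise

variable {Ω : Type*} [MeasurableSpace Ω] {μ : Measure Ω}

lemma integrable_exp_mul_of_le {v : Ω → ℝ} (hv : Measurable v)
    (hint : Integrable (fun ω => Real.exp (v ω)) μ) (hv0 : ∀ ω, 0 ≤ v ω)
    {s : ℝ} (hs1 : s ≤ 1) :
    Integrable (fun ω => Real.exp (s * v ω)) μ := by
  refine hint.mono' (by fun_prop) (ae_of_all _ fun ω => ?_)
  rw [Real.norm_eq_abs, abs_of_pos (Real.exp_pos _)]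
  exact Real.exp_le_exp.2 (by nlinarith [hv0 ω])

variable [IsProbabilityMeasure μ]

lemma integral_exp_mul_le {v : Ω → ℝ} (hv : Measurable v)
    (hint : Integrable (fun ω => Real.exp (v ω)) μ) (hv0 : ∀ ω, 0 ≤ v ω)
    {s : ℝ} (hs : 0 ≤ s) (hs1 : s ≤ 1) :
    ∫ ω, Real.exp (s * v ω) ∂μ ≤ Real.exp (s * (∫ ω, Real.exp (v ω) ∂μ - 1)) := by
  have hi : Integrable (fun ω => s * (Real.exp (v ω) - 1)) μ :=
    (hint.sub (integrable_const 1)).const_mul s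
  calc ∫ ω, Real.exp (s * v ω) ∂μ
      ≤ ∫ ω, (1 + s * (Real.exp (v ω) - 1)) ∂μ :=
        integral_mono (integrable_exp_mul_of_le hv hint hv0 hs1)
          ((integrable_const 1).add hi) fun ω => exp_mul_le_one_add hs hs1 _
    _ = s * (∫ ω, Real.exp (v ω) ∂μ - 1) + 1 := by
        rw [integral_add (integrable_const 1) hi, integral_const_mul,
          integral_sub hint (integrable_const 1)]
        simp [add_comm]
    _ ≤ _ := Real.add_one_le_exp _

lemma hasSubgaussianMGF_of_integral_exp_sq {u : Ω → ℝ} {K γ : ℝ} (hK : 0 < K)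
    (hu : Measurable u) (hint : Integrable u μ) (hcent : ∫ ω, u ω ∂μ = 0)
    (hexp : Integrable (fun ω => Real.exp (|u ω| ^ 2 / K ^ 2)) μ)
    (hbound : K ^ 2 * (∫ ω, Real.exp (|u ω| ^ 2 / K ^ 2) ∂μ - 1) ≤ γ ^ 2) :
    HasSubgaussianMGF u ⟨K ^ 2 + 2 * γ ^ 2, by positivity⟩ μ := by
  have hK2 : 0 < K ^ 2 := by positivity
  set v : Ω → ℝ := fun ω => |u ω| ^ 2 / K ^ 2 with hv
  have hvm : Measurable v := by fun_prop
  have hv0 : ∀ ω, 0 ≤ v ω := fun ω => by positivity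
  have hI : ∫ ω, Real.exp (v ω) ∂μ - 1 ≤ γ ^ 2 / K ^ 2 := by
    rw [le_div_iff₀ hK2]; linarith
  have young : ∀ t ω, t * u ω ≤ t ^ 2 * K ^ 2 / 2 + (1 / 2) * v ω := by
    intro t ω
    have h1 : t * u ω = t * K * (u ω / K) := by field_simp
    have h2 : v ω = (u ω / K) ^ 2 := by simp only [hv, sq_abs, div_pow]
    rw [h1, h2]
    nlinarith [sq_nonneg (t * K - u ω / K)]
  have hhalf := integrable_exp_mul_of_le (s := 1 / 2) hvm hexp hv0 (by norm_num)
  have hinte : ∀ t : ℝ, Integrable (fun ω => Real.exp (t * u ω)) μ := by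
    intro t
    refine (hhalf.const_mul (Real.exp (t ^ 2 * K ^ 2 / 2))).mono' (by fun_prop)
      (ae_of_all _ fun ω => ?_)
    rw [Real.norm_eq_abs, abs_of_pos (Real.exp_pos _), ← Real.exp_add]
    exact Real.exp_le_exp.2 (young t ω)
  refine ⟨hinte, fun t => ?_⟩
  change ∫ ω, Real.exp (t * u ω) ∂μ ≤ Real.exp ((K ^ 2 + 2 * γ ^ 2) * t ^ 2 / 2)
  rcases le_or_gt (t ^ 2 * K ^ 2) 1 with h | h
  · have hs0 : 0 ≤ t ^ 2 * K ^ 2 := by positivity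
    have hi := integrable_exp_mul_of_le (s := t ^ 2 * K ^ 2) hvm hexp hv0 h
    calc ∫ ω, Real.exp (t * u ω) ∂μ
        ≤ ∫ ω, (t * u ω + Real.exp (t ^ 2 * K ^ 2 * v ω)) ∂μ := by
          refine integral_mono (hinte t) ((hint.const_mul t).add hi) fun ω => ?_
          refine (exp_le_add_exp_sq _).trans_eq ?_
          congr 2
          simp only [hv, sq_abs]
          field_simp
      _ = ∫ ω, Real.exp (t ^ 2 * K ^ 2 * v ω) ∂μ := by
          rw [integral_add (hint.const_mul t) hi, integral_const_mul, hcent]; simp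
      _ ≤ _ := integral_exp_mul_le hvm hexp hv0 hs0 h
      _ ≤ _ := by
          refine Real.exp_le_exp.2 ?_
          calc t ^ 2 * K ^ 2 * (∫ ω, Real.exp (v ω) ∂μ - 1)
              = t ^ 2 * (K ^ 2 * (∫ ω, Real.exp (v ω) ∂μ - 1)) := by ring
            _ ≤ t ^ 2 * γ ^ 2 := by gcongr
            _ ≤ _ := by nlinarith [mul_nonneg (sq_nonneg t) hK2.le]
  · calc ∫ ω, Real.exp (t * u ω) ∂μ
        ≤ ∫ ω, Real.exp (t ^ 2 * K ^ 2 / 2) * Real.exp ((1 / 2) * v ω) ∂μ := by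
          refine integral_mono (hinte t) (hhalf.const_mul _) fun ω => ?_
          rw [← Real.exp_add]
          exact Real.exp_le_exp.2 (young t ω)
      _ ≤ Real.exp (t ^ 2 * K ^ 2 / 2) *
            Real.exp ((1 / 2) * (∫ ω, Real.exp (v ω) ∂μ - 1)) := by
          rw [integral_const_mul]
          gcongr
          exact integral_exp_mul_le hvm hexp hv0 (by norm_num) (by norm_num)
      _ ≤ _ := by
          rw [← Real.exp_add]
          refine Real.exp_le_exp.2 ?_
          have : γ ^ 2 / K ^ 2 ≤ t ^ 2 * γ ^ 2 := by
            rw [div_le_iff₀ hK2]; nlinarith [sq_nonneg γ]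
          nlinarith [mul_nonneg (sq_nonneg t) (sq_nonneg γ)]

lemma IsSubGaussianNoise.hasSubgaussianMGF_sum {n : ℕ} {u : Fin n → Ω → ℝ} {K γ : ℝ}
    (hK : 0 < K) (hu : IsSubGaussianNoise μ u K γ) (c : Fin n → ℝ) {v : ℝ}
    (hv : ∑ i, c i ^ 2 ≤ v) :
    HasSubgaussianMGF (fun ω => ∑ i, c i * u i ω)
      (Real.toNNReal ((K ^ 2 + 2 * γ ^ 2) * v)) μ := by
  let σ : Fin n → NNReal := fun i =>
    (⟨c i ^ 2, sq_nonneg _⟩ : NNReal) * (⟨K ^ 2 + 2 * γ ^ 2, by positivity⟩ : NNReal)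
  have h1 : ∀ i, HasSubgaussianMGF (fun ω => c i * u i ω) (σ i) μ := fun i =>
    (hasSubgaussianMGF_of_integral_exp_sq hK (hu.measurable i) (hu.integrable i)
      (hu.centered i) (hu.integrable_exp i) (hu.subGaussian i)).const_mul _
  have hind : iIndepFun (fun i ω => c i * u i ω) μ :=
    hu.indep.comp (fun i z => c i * z) fun i => by fun_prop
  have h2 := HasSubgaussianMGF.sum_of_iIndepFun hind (s := Finset.univ) fun i _ => h1 i
  refine ⟨h2.integrable_exp_mul, fun t => (h2.mgf_le t).trans (Real.exp_le_exp.2 ?_)⟩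
  have hc : ((∑ i, σ i : NNReal) : ℝ) ≤ (K ^ 2 + 2 * γ ^ 2) * v := by
    have hσ : ∀ i, (σ i : ℝ) = c i ^ 2 * (K ^ 2 + 2 * γ ^ 2) := fun i => rfl
    rw [NNReal.coe_sum, Finset.sum_congr rfl fun i _ => hσ i, ← Finset.sum_mul, mul_comm]
    gcongr
  have := hc.trans (Real.le_coe_toNNReal _)
  gcongr

end Noise

section Chaining

open Filter Topology

lemma exists_binary_expansion {x : ℝ} (hx : 0 ≤ x) (hx1 : x ≤ 1) :
    ∃ p : ℕ → Prop, ∃ _ : DecidablePred p, ∀ J,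
      ∑ i ∈ Finset.range J, (1 / 2 : ℝ) ^ i * (if p i then 1 else 0) ≤ x ∧
      x ≤ ∑ i ∈ Finset.range J, (1 / 2 : ℝ) ^ i * (if p i then 1 else 0) + 2 * (1 / 2) ^ J := by
  classical
  set c : ℕ → ℕ := fun j => ⌊2 ^ j * (x / 2)⌋₊ with hc
  have hcle : ∀ j, (c j : ℝ) ≤ 2 ^ j * (x / 2) := fun j => Nat.floor_le (by positivity)
  have hclt : ∀ j, 2 ^ j * (x / 2) < c j + 1 := fun j => Nat.lt_floor_add_one _
  have hc0 : c 0 = 0 := by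
    simp only [hc, Nat.floor_eq_zero]
    linarith
  have hstep : ∀ j, c (j + 1) = 2 * c j ∨ c (j + 1) = 2 * c j + 1 := by
    intro j
    have h1 := hcle j
    have h2 := hclt j
    have h3 := hcle (j + 1)
    have h4 := hclt (j + 1)
    rw [pow_succ] at h3 h4
    have h5 : c (j + 1) < 2 * c j + 2 := by
      have : (c (j + 1) : ℝ) < 2 * c j + 2 := by linarith
      exact_mod_cast this
    have h6 : 2 * c j < c (j + 1) + 1 := by
      have : (2 * c j : ℝ) < c (j + 1) + 1 := by linarith
      exact_mod_cast this
    omega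
  have hsum : ∀ J, ∑ i ∈ Finset.range J, (1 / 2 : ℝ) ^ i *
      (if c (i + 1) = 2 * c i + 1 then 1 else 0) = 2 * (1 / 2) ^ J * c J := by
    intro J
    induction J with
    | zero => simp [hc0]
    | succ J ih =>
      rw [Finset.sum_range_succ, ih]
      rcases hstep J with h | h <;> simp [h, pow_succ] <;> ring
  refine ⟨fun i => c (i + 1) = 2 * c i + 1, inferInstance, fun J => ?_⟩
  rw [hsum J]
  have hJ : (1 / 2 : ℝ) ^ J * 2 ^ J = 1 := by rw [← mul_pow]; norm_num
  have hpos : (0 : ℝ) < (1 / 2) ^ J := by positivity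
  have hx' : x = 2 * (1 / 2) ^ J * (2 ^ J * (x / 2)) := by
    linear_combination (-x) * hJ
  constructor
  · conv_rhs => rw [hx']
    gcongr
    exact hcle J
  · conv_lhs => rw [hx']
    have := (mul_lt_mul_of_pos_left (hclt J) hpos).le
    linarith

lemma exists_signed_binary_expansion {t : ℝ} (ht : |t| ≤ 1) :
    ∃ b : ℕ → SignType,
      (∀ J, ∑ i ∈ Finset.range J, (1 / 2 : ℝ) ^ i * |(b i : ℝ)| ≤ |t|) ∧
      Tendsto (fun J => ∑ i ∈ Finset.range J, (1 / 2 : ℝ) ^ i * (b i : ℝ)) atTop (𝓝 t) := by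
  obtain ⟨p, hp, h⟩ := exists_binary_expansion (abs_nonneg t) ht
  refine ⟨fun i => if p i then SignType.sign t else 0, fun J => ?_, ?_⟩
  · refine le_trans (Finset.sum_le_sum fun i _ => ?_) (h J).1
    gcongr
    by_cases hi : p i
    · rcases lt_trichotomy t 0 with ht | ht | ht <;> simp [hi, ht]
    · simp [hi]
  · have hsgn : ∀ J, ∑ i ∈ Finset.range J, (1 / 2 : ℝ) ^ i *
        (((if p i then SignType.sign t else 0 : SignType)) : ℝ) =
        (SignType.sign t : ℝ) *
          ∑ i ∈ Finset.range J, (1 / 2 : ℝ) ^ i * (if p i then 1 else 0) := by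
      intro J
      rw [Finset.mul_sum]
      refine Finset.sum_congr rfl fun i _ => ?_
      by_cases hi : p i <;> simp [hi, mul_comm]
    have hlim : Tendsto (fun J => ∑ i ∈ Finset.range J, (1 / 2 : ℝ) ^ i *
        (if p i then 1 else 0)) atTop (𝓝 |t|) := by
      have hz : Tendsto (fun J : ℕ => |t| - 2 * (1 / 2 : ℝ) ^ J) atTop (𝓝 |t|) := by
        have := (tendsto_pow_atTop_nhds_zero_of_lt_one (r := (1 / 2 : ℝ)) (by norm_num)
          (by norm_num)).const_mul 2 |>.const_sub |t|
        simpa using this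
      exact tendsto_of_tendsto_of_tendsto_of_le_of_le hz tendsto_const_nhds
        (fun J => by have := (h J).2; simp only; linarith) fun J => (h J).1
    have := hlim.const_mul (SignType.sign t : ℝ)
    rw [sign_mul_abs] at this
    exact this.congr fun J => (hsgn J).symm

lemma sum_half_pow_le (J : ℕ) : ∑ j ∈ Finset.range J, (1 / 2 : ℝ) ^ j ≤ 2 := by
  have : ∑ j ∈ Finset.range J, (1 / 2 : ℝ) ^ j = 2 - 2 * (1 / 2) ^ J := by
    induction J with
    | zero => simp
    | succ J ih => rw [Finset.sum_range_succ, ih, pow_succ]; ring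
  rw [this]
  have : (0 : ℝ) < (1 / 2) ^ J := by positivity
  linarith

lemma sum_half_pow_mul_le (J : ℕ) :
    ∑ j ∈ Finset.range J, (1 / 2 : ℝ) ^ j * (j + 1) ≤ 4 := by
  have : ∑ j ∈ Finset.range J, (1 / 2 : ℝ) ^ j * (j + 1) = 4 - 2 * (J + 2) * (1 / 2) ^ J := by
    induction J with
    | zero => norm_num
    | succ J ih => rw [Finset.sum_range_succ, ih, pow_succ]; push_cast; ring
  rw [this]
  have : (0 : ℝ) ≤ 2 * (J + 2) * (1 / 2) ^ J := by positivity
  linarith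

lemma sum_half_pow_mul_sum_le {s : ℕ → ℝ} (hs : ∀ i, 0 ≤ s i) (J : ℕ) :
    ∑ j ∈ Finset.range J, (1 / 2 : ℝ) ^ j * ∑ i ∈ Finset.range (j + 1), s i ≤
      2 * ∑ i ∈ Finset.range J, (1 / 2 : ℝ) ^ i * s i := by
  have : ∑ j ∈ Finset.range J, (1 / 2 : ℝ) ^ j * ∑ i ∈ Finset.range (j + 1), s i =
      2 * ∑ i ∈ Finset.range J, (1 / 2 : ℝ) ^ i * s i -
        2 * (1 / 2) ^ J * ∑ i ∈ Finset.range J, s i := by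
    induction J with
    | zero => simp
    | succ J ih =>
      rw [Finset.sum_range_succ, ih, Finset.sum_range_succ _ J, Finset.sum_range_succ _ J,
        pow_succ]
      ring
  rw [this]
  have : (0 : ℝ) ≤ 2 * (1 / 2) ^ J * ∑ i ∈ Finset.range J, s i :=
    mul_nonneg (by positivity) (Finset.sum_nonneg fun i _ => hs i)
  linarith

variable {ι : Type*}

/-- The point `∑ i < j, 2⁻ⁱ β i` with signed binary digits `β`. -/
def signedPoint {j : ℕ} (β : Fin j → ι → SignType) : ι → ℝ :=
  fun k => ∑ i : Fin j, (1 / 2 : ℝ) ^ (i : ℕ) * ((β i k : SignType) : ℝ)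

lemma signedPoint_succ {j : ℕ} (β : Fin (j + 1) → ι → SignType) (k : ι) :
    signedPoint β k = signedPoint (fun i : Fin j => β i.castSucc) k +
      (1 / 2) ^ j * ((β (Fin.last j) k : SignType) : ℝ) := by
  simp [signedPoint, Fin.sum_univ_castSucc]

variable [Fintype ι]

/-- The number of nonzero entries of a sign vector. -/
def supportSize (b : ι → SignType) : ℝ := ∑ k, |(b k : ℝ)|

lemma supportSize_nonneg (b : ι → SignType) : 0 ≤ supportSize b :=
  Finset.sum_nonneg fun _ _ => abs_nonneg _

/-- The union-bound weight of a sequence of sign vectors. -/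
def signWeight {j : ℕ} (β : Fin j → ι → SignType) : ℝ :=
  Real.exp (-(2 * j + Real.log (2 * Fintype.card ι) * ∑ i, supportSize (β i)))

lemma sum_exp_supportSize_le [DecidableEq ι] [Nonempty ι] :
    ∑ b : ι → SignType, Real.exp (-(Real.log (2 * Fintype.card ι) * supportSize b)) ≤
      Real.exp 1 := by
  set ℓ := Real.log (2 * Fintype.card ι) with hℓ
  have hP : (0 : ℝ) < Fintype.card ι := by exact_mod_cast Fintype.card_pos
  have hexp : Real.exp (-ℓ) = (2 * (Fintype.card ι : ℝ))⁻¹ := by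
    rw [Real.exp_neg, hℓ, Real.exp_log (by positivity)]
  have h1 : ∑ s : SignType, Real.exp (-(ℓ * |(s : ℝ)|)) = 1 + (Fintype.card ι : ℝ)⁻¹ := by
    have : (Finset.univ : Finset SignType) = {0, -1, 1} := rfl
    rw [this]
    simp [hexp]
    ring
  calc ∑ b : ι → SignType, Real.exp (-(ℓ * supportSize b))
      = ∑ b : ι → SignType, ∏ k, Real.exp (-(ℓ * |(b k : ℝ)|)) := by
        refine Finset.sum_congr rfl fun b _ => ?_
        rw [← Real.exp_sum, supportSize, Finset.mul_sum, Finset.sum_neg_distrib]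
    _ = ∏ _k : ι, ∑ s : SignType, Real.exp (-(ℓ * |(s : ℝ)|)) := by
        rw [Finset.prod_univ_sum, Fintype.piFinset_univ]
    _ = (1 + (Fintype.card ι : ℝ)⁻¹) ^ Fintype.card ι := by
        rw [h1, Finset.prod_const, Finset.card_univ]
    _ ≤ Real.exp ((Fintype.card ι : ℝ)⁻¹) ^ Fintype.card ι := by
        gcongr
        rw [add_comm]
        exact Real.add_one_le_exp _
    _ = Real.exp 1 := by
        rw [← Real.exp_nat_mul, mul_inv_cancel₀ hP.ne']

lemma sum_signWeight_le [DecidableEq ι] [Nonempty ι] (j : ℕ) :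
    ∑ β : Fin j → ι → SignType, signWeight β ≤ (1 / 2) ^ j := by
  have h : ∀ β : Fin j → ι → SignType, signWeight β =
      ∏ i, (Real.exp (-2) *
        Real.exp (-(Real.log (2 * Fintype.card ι) * supportSize (β i)))) := by
    intro β
    rw [Finset.prod_mul_distrib, ← Real.exp_sum, ← Real.exp_sum, ← Real.exp_add, signWeight]
    congr 1
    simp [Finset.mul_sum]
    ring
  rw [Finset.sum_congr rfl fun β _ => h β, ← Fintype.sum_pow (fun b : ι → SignType => Real.exp (-2) *
    Real.exp (-(Real.log (2 * Fintype.card ι) * supportSize b))), ← Finset.mul_sum]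
  have hs := sum_exp_supportSize_le (ι := ι)
  gcongr
  calc _ ≤ Real.exp (-2) * Real.exp 1 := by gcongr
    _ = Real.exp (-1) := by rw [← Real.exp_add]; norm_num
    _ ≤ 1 / 2 := by
      rw [Real.exp_neg, one_div]
      have := Real.add_one_le_exp (1 : ℝ)
      gcongr
      linarith

lemma sum_abs_signedPoint_le {j : ℕ} (β : Fin j → ι → SignType) :
    ∑ k, |signedPoint β k| ≤ ∑ i : Fin j, (1 / 2) ^ (i : ℕ) * supportSize (β i) := by
  simp only [supportSize, Finset.mul_sum]
  rw [Finset.sum_comm]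
  refine Finset.sum_le_sum fun k _ => (Finset.abs_sum_le_sum_abs _ _).trans_eq ?_
  refine Finset.sum_congr rfl fun i _ => ?_
  rw [abs_mul, abs_of_pos (by positivity)]

lemma sum_sq_signedPoint_sub {j : ℕ} (β : Fin (j + 1) → ι → SignType) :
    ∑ k, (signedPoint β k - signedPoint (fun i : Fin j => β i.castSucc) k) ^ 2 =
      ((1 / 2) ^ j) ^ 2 * supportSize (β (Fin.last j)) := by
  rw [supportSize, Finset.mul_sum]
  refine Finset.sum_congr rfl fun k _ => ?_
  rw [signedPoint_succ, add_sub_cancel_left, mul_pow]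
  congr 1
  rcases β (Fin.last j) k with _ | _ | _ <;> simp

/-- The bound for the increment at level `j` of a process along signed binary digits. -/
def incrementBound (v Λ D : ℝ) {j : ℕ} (β : Fin (j + 1) → ι → SignType) : ℝ :=
  v * Λ / 2 * ((1 / 2) ^ j * supportSize (β (Fin.last j))) +
    (1 / 2) ^ j * (2 * (j + 1) + Real.log (2 * Fintype.card ι) * ∑ i, supportSize (β i) + D) / Λ

lemma sum_incrementBound_le {v Λ D : ℝ} (hv : 0 ≤ v) (hΛ : 0 < Λ) (hD : 0 ≤ D)
    (b : ℕ → ι → SignType)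
    (hb : ∀ J, ∑ i ∈ Finset.range J, (1 / 2 : ℝ) ^ i * supportSize (b i) ≤ 1) (J : ℕ) :
    ∑ j ∈ Finset.range J, incrementBound v Λ D (fun i : Fin (j + 1) => b i) ≤
      v * Λ / 2 + (2 * Real.log (2 * Fintype.card ι) + 8 + 2 * D) / Λ := by
  set ℓ := Real.log (2 * Fintype.card ι) with hℓ
  have hℓ0 : 0 ≤ ℓ := by
    rw [hℓ]
    exact_mod_cast Real.log_natCast_nonneg (2 * Fintype.card ι)
  have h : ∀ j, incrementBound v Λ D (fun i : Fin (j + 1) => b i) =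
      v * Λ / 2 * ((1 / 2) ^ j * supportSize (b j)) +
      (2 * ((1 / 2) ^ j * (j + 1)) +
        ℓ * ((1 / 2) ^ j * ∑ i ∈ Finset.range (j + 1), supportSize (b i)) +
        D * (1 / 2) ^ j) / Λ := by
    intro j
    rw [incrementBound, Fin.sum_univ_eq_sum_range (fun i => supportSize (b i)) (j + 1), ← hℓ,
      Fin.val_last]
    ring
  rw [Finset.sum_congr rfl fun j _ => h j, Finset.sum_add_distrib, ← Finset.mul_sum,
    ← Finset.sum_div, Finset.sum_add_distrib, Finset.sum_add_distrib, ← Finset.mul_sum,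
    ← Finset.mul_sum, ← Finset.mul_sum]
  have h1 := hb J
  have h2 := sum_half_pow_mul_le J
  have h3 := sum_half_pow_mul_sum_le (fun i => supportSize_nonneg (b i)) J
  have h4 := sum_half_pow_le J
  have h5 : ∑ j ∈ Finset.range J, (1 / 2 : ℝ) ^ j *
      ∑ i ∈ Finset.range (j + 1), supportSize (b i) ≤ 2 := by linarith
  have h6 := mul_le_mul_of_nonneg_left h5 hℓ0
  have h7 := mul_le_mul_of_nonneg_left h4 hD
  refine add_le_add (mul_le_of_le_one_right (by positivity) h1) ?_
  exact div_le_div_of_nonneg_right (by linarith) hΛ.le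

variable {Ω : Type*} [MeasurableSpace Ω] {μ : Measure Ω} [IsProbabilityMeasure μ]

lemma measureReal_le_abs_le_of_hasSubgaussianMGF {Y : Ω → ℝ} {c : NNReal}
    (hY : HasSubgaussianMGF Y c μ) {t : ℝ} (ht : 0 ≤ t) (ε : ℝ) :
    μ.real {ω | ε ≤ |Y ω|} ≤ 2 * Real.exp (-(t * ε) + c * t ^ 2 / 2) := by
  have key : ∀ Z : Ω → ℝ, HasSubgaussianMGF Z c μ →
      μ.real {ω | ε ≤ Z ω} ≤ Real.exp (-(t * ε) + c * t ^ 2 / 2) := by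
    intro Z hZ
    refine (measure_ge_le_exp_mul_mgf ε ht (hZ.integrable_exp_mul t)).trans ?_
    rw [Real.exp_add, neg_mul]
    gcongr
    exact hZ.mgf_le t
  calc μ.real {ω | ε ≤ |Y ω|} ≤ μ.real ({ω | ε ≤ Y ω} ∪ {ω | ε ≤ (-Y) ω}) :=
        measureReal_mono fun ω hω =>
          (le_abs.1 (show ε ≤ |Y ω| from hω) : ε ≤ Y ω ∨ ε ≤ -Y ω)
    _ ≤ _ := measureReal_union_le _ _
    _ ≤ _ := by linarith [key Y hY, key (-Y) hY.neg]

lemma measureReal_increment_le {X : (ι → ℝ) → Ω → ℝ} {v : ℝ} (hv : 0 ≤ v)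
    (hX : ∀ θ θ' : ι → ℝ, ∑ k, |θ k| ≤ 1 → ∑ k, |θ' k| ≤ 1 →
      HasSubgaussianMGF (fun ω => X θ ω - X θ' ω)
        (Real.toNNReal (v * ∑ k, (θ k - θ' k) ^ 2)) μ)
    {Λ : ℝ} (hΛ : 0 < Λ) {δ : ℝ} (hδ : 0 < δ) {j : ℕ} (β : Fin (j + 1) → ι → SignType)
    (hβ : ∑ i : Fin (j + 1), (1 / 2 : ℝ) ^ (i : ℕ) * supportSize (β i) ≤ 1) :
    μ.real {ω | incrementBound v Λ (Real.log (2 / δ)) β ≤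
      |X (signedPoint β) ω - X (signedPoint fun i : Fin j => β i.castSucc) ω|} ≤
      δ * signWeight β := by
  have h1 : ∑ k, |signedPoint β k| ≤ 1 := (sum_abs_signedPoint_le β).trans hβ
  have h2 : ∑ k, |signedPoint (fun i : Fin j => β i.castSucc) k| ≤ 1 := by
    refine (sum_abs_signedPoint_le _).trans (le_trans ?_ hβ)
    rw [Fin.sum_univ_castSucc]
    exact le_add_of_nonneg_right (mul_nonneg (by positivity) (supportSize_nonneg _))
  have h := hX _ _ h1 h2
  rw [sum_sq_signedPoint_sub] at h
  have hp : (1 / 2 : ℝ) ^ j * 2 ^ j = 1 := by rw [← mul_pow]; norm_num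
  refine (measureReal_le_abs_le_of_hasSubgaussianMGF h (t := Λ * 2 ^ j) (by positivity)
    _).trans_eq ?_
  have hc : (Real.toNNReal (v * (((1 / 2) ^ j) ^ 2 * supportSize (β (Fin.last j)))) : ℝ) =
      v * (((1 / 2) ^ j) ^ 2 * supportSize (β (Fin.last j))) :=
    Real.coe_toNNReal _ (mul_nonneg hv (mul_nonneg (by positivity) (supportSize_nonneg _)))
  have he : -(Λ * 2 ^ j * incrementBound v Λ (Real.log (2 / δ)) β) +
      v * (((1 / 2) ^ j) ^ 2 * supportSize (β (Fin.last j))) * (Λ * 2 ^ j) ^ 2 / 2 =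
      -Real.log (2 / δ) + -(2 * ((j + 1 : ℕ) : ℝ) +
        Real.log (2 * Fintype.card ι) * ∑ i, supportSize (β i)) := by
    rw [incrementBound]
    push_cast
    set S := ∑ i, supportSize (β i)
    set s := supportSize (β (Fin.last j))
    set ℓ := Real.log (2 * Fintype.card ι)
    set D := Real.log (2 / δ)
    have e1 : Λ * 2 ^ j * (v * Λ / 2 * ((1 / 2) ^ j * s) +
        (1 / 2) ^ j * (2 * (j + 1) + ℓ * S + D) / Λ) =
        ((1 / 2) ^ j * 2 ^ j) * (v * Λ ^ 2 / 2 * s + (2 * (j + 1) + ℓ * S + D)) := by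
      field_simp
    have e2 : v * (((1 / 2) ^ j) ^ 2 * s) * (Λ * 2 ^ j) ^ 2 / 2 =
        ((1 / 2) ^ j * 2 ^ j) ^ 2 * (v * Λ ^ 2 / 2 * s) := by ring
    rw [e1, e2, hp]
    ring
  rw [hc, he, Real.exp_add, Real.exp_neg, Real.exp_log (by positivity), signWeight]
  field_simp

/-- Uniform bound over the `ℓ¹` unit ball for a process that has sub-Gaussian increments with
respect to the `ℓ²` distance; it has the order of the Gaussian width of the ball. -/
theorem exists_event_forall_abs_le [Nonempty ι] {X : (ι → ℝ) → Ω → ℝ}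
    (hmeas : ∀ θ, Measurable (X θ)) (hzero : ∀ ω, X 0 ω = 0)
    (hcont : ∀ ω, ContinuousOn (fun θ => X θ ω) {θ | ∑ k, |θ k| ≤ 1})
    {v : ℝ} (hv : 0 ≤ v)
    (hX : ∀ θ θ' : ι → ℝ, ∑ k, |θ k| ≤ 1 → ∑ k, |θ' k| ≤ 1 →
      HasSubgaussianMGF (fun ω => X θ ω - X θ' ω)
        (Real.toNNReal (v * ∑ k, (θ k - θ' k) ^ 2)) μ)
    {Λ : ℝ} (hΛ : 0 < Λ) {δ : ℝ} (hδ : 0 < δ) (hδ1 : δ ≤ 1) :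
    ∃ E : Set Ω, MeasurableSet E ∧ 1 - δ ≤ μ.real E ∧ ∀ ω ∈ E, ∀ θ : ι → ℝ, ∑ k, |θ k| ≤ 1 →
      |X θ ω| ≤ v * Λ / 2 +
        (2 * Real.log (2 * Fintype.card ι) + 8 + 2 * Real.log (2 / δ)) / Λ := by
  classical
  set D := Real.log (2 / δ) with hD
  have hD0 : 0 ≤ D := Real.log_nonneg (by rw [le_div_iff₀ hδ]; linarith)
  let B : (j : ℕ) → (Fin (j + 1) → ι → SignType) → Set Ω := fun j β =>
    {ω | ∑ i : Fin (j + 1), (1 / 2 : ℝ) ^ (i : ℕ) * supportSize (β i) ≤ 1 ∧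
      incrementBound v Λ D β ≤
        |X (signedPoint β) ω - X (signedPoint fun i : Fin j => β i.castSucc) ω|}
  have hBm : ∀ j β, MeasurableSet (B j β) := fun j β =>
    (MeasurableSet.const _).inter (measurableSet_le measurable_const
      (((hmeas _).sub (hmeas _)).abs))
  have hBμ : ∀ j β, μ (B j β) ≤ ENNReal.ofReal (δ * signWeight β) := by
    intro j β
    by_cases hβ : ∑ i : Fin (j + 1), (1 / 2 : ℝ) ^ (i : ℕ) * supportSize (β i) ≤ 1
    · have h := measureReal_increment_le hv hX hΛ hδ β hβ
      rw [← ofReal_measureReal]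
      refine ENNReal.ofReal_le_ofReal (le_trans (measureReal_mono fun ω hω => hω.2) h)
    · have : B j β = ∅ := Set.eq_empty_of_forall_notMem fun ω hω => hβ hω.1
      simp [this]
  have hU : μ (⋃ j, ⋃ β, B j β) ≤ ENNReal.ofReal δ := by
    calc μ (⋃ j, ⋃ β, B j β) ≤ ∑' j, μ (⋃ β, B j β) := measure_iUnion_le _
      _ ≤ ∑' j : ℕ, ENNReal.ofReal (δ * (1 / 2) ^ (j + 1)) := by
          refine ENNReal.tsum_le_tsum fun j => ?_
          calc μ (⋃ β, B j β) ≤ ∑' β, μ (B j β) := measure_iUnion_le _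
            _ = ∑ β, μ (B j β) := tsum_fintype _
            _ ≤ ∑ β : Fin (j + 1) → ι → SignType, ENNReal.ofReal (δ * signWeight β) :=
                Finset.sum_le_sum fun β _ => hBμ j β
            _ = ENNReal.ofReal (∑ β : Fin (j + 1) → ι → SignType, δ * signWeight β) :=
                (ENNReal.ofReal_sum_of_nonneg fun β _ =>
                  mul_nonneg hδ.le (Real.exp_pos _).le).symm
            _ ≤ _ := by
                rw [← Finset.mul_sum]
                exact ENNReal.ofReal_le_ofReal
                  (mul_le_mul_of_nonneg_left (sum_signWeight_le _) hδ.le)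
      _ = ENNReal.ofReal δ := by
          have hs : HasSum (fun j : ℕ => δ * (1 / 2 : ℝ) ^ (j + 1)) δ := by
            have := (hasSum_geometric_two.mul_left (δ / 2))
            have h2 : δ / 2 * 2 = δ := by ring
            rw [h2] at this
            have h3 : (fun j : ℕ => δ * (1 / 2 : ℝ) ^ (j + 1)) =
                fun j => δ / 2 * (1 / 2) ^ j := funext fun j => by rw [pow_succ]; ring
            rwa [h3]
          rw [← ENNReal.ofReal_tsum_of_nonneg (fun j => by positivity) hs.summable, hs.tsum_eq]
  have hUm : MeasurableSet (⋃ j, ⋃ β, B j β) :=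
    MeasurableSet.iUnion fun j => MeasurableSet.iUnion fun β => hBm j β
  refine ⟨(⋃ j, ⋃ β, B j β)ᶜ, hUm.compl, ?_, fun ω hω θ hθ => ?_⟩
  · rw [probReal_compl_eq_one_sub hUm]
    have : μ.real (⋃ j, ⋃ β, B j β) ≤ δ := ENNReal.toReal_le_of_le_ofReal hδ.le hU
    linarith
  · have hθk : ∀ k, |θ k| ≤ 1 := fun k =>
      (Finset.single_le_sum (f := fun k => |θ k|) (fun _ _ => abs_nonneg _)
        (Finset.mem_univ k)).trans hθ
    choose c hc hlim using fun k => exists_signed_binary_expansion (hθk k)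
    let b : ℕ → ι → SignType := fun i k => c k i
    have hb : ∀ J, ∑ i ∈ Finset.range J, (1 / 2 : ℝ) ^ i * supportSize (b i) ≤ 1 := by
      intro J
      simp only [supportSize, Finset.mul_sum]
      rw [Finset.sum_comm]
      exact (Finset.sum_le_sum fun k _ => hc k J).trans hθ
    let p : ℕ → ι → ℝ := fun J => signedPoint fun i : Fin J => b i
    have hp : ∀ J k, p J k = ∑ i ∈ Finset.range J, (1 / 2 : ℝ) ^ i * (c k i : ℝ) := fun J k =>
      Fin.sum_univ_eq_sum_range (fun i => (1 / 2 : ℝ) ^ i * (c k i : ℝ)) J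
    have hb' : ∀ J, ∑ i : Fin J, (1 / 2 : ℝ) ^ (i : ℕ) * supportSize (b i) ≤ 1 := fun J => by
      rw [Fin.sum_univ_eq_sum_range (fun i => (1 / 2 : ℝ) ^ i * supportSize (b i)) J]
      exact hb J
    have hpmem : ∀ J, ∑ k, |p J k| ≤ 1 := fun J => (sum_abs_signedPoint_le _).trans (hb' J)
    have hstep : ∀ j, |X (p (j + 1)) ω - X (p j) ω| ≤
        incrementBound v Λ D (fun i : Fin (j + 1) => b i) := by
      intro j
      by_contra! hlt
      exact hω (Set.mem_iUnion.2 ⟨j, Set.mem_iUnion.2 ⟨fun i => b i, hb' _, hlt.le⟩⟩)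
    have hXp : ∀ J, |X (p J) ω| ≤
        ∑ j ∈ Finset.range J, incrementBound v Λ D (fun i : Fin (j + 1) => b i) := by
      intro J
      induction J with
      | zero =>
        have : p 0 = 0 := by ext k; simp [hp]
        simp [this, hzero]
      | succ J ih =>
        rw [Finset.sum_range_succ]
        have := abs_add_le (X (p J) ω) (X (p (J + 1)) ω - X (p J) ω)
        rw [add_sub_cancel] at this
        linarith [hstep J]
    have htend : Tendsto p atTop (𝓝[{θ | ∑ k, |θ k| ≤ 1}] θ) := by
      refine tendsto_nhdsWithin_iff.2 ⟨tendsto_pi_nhds.2 fun k => ?_, Eventually.of_forall hpmem⟩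
      exact (hlim k).congr fun J => (hp J k).symm
    have hXlim := ((hcont ω θ hθ).tendsto.comp htend).abs
    exact le_of_tendsto hXlim (Eventually.of_forall fun J =>
      (hXp J).trans (sum_incrementBound_le hv hΛ hD0 b hb J))

end Chaining

variable {L : ℕ}

section Regularizer

lemma vecL1_nonneg {m : ℕ} (v : EuclideanSpace ℝ (Fin m)) : 0 ≤ vecL1 v :=
  Finset.sum_nonneg fun _ _ => abs_nonneg _

lemma vecL1_add_le {m : ℕ} (v w : EuclideanSpace ℝ (Fin m)) :
    vecL1 (v + w) ≤ vecL1 v + vecL1 w := by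
  rw [vecL1, vecL1, vecL1, ← Finset.sum_add_distrib]
  exact Finset.sum_le_sum fun k _ => abs_add_le _ _

lemma vecL1_le_card_mul_norm {m : ℕ} (v : EuclideanSpace ℝ (Fin m)) :
    vecL1 v ≤ m * ‖v‖ := by
  calc vecL1 v ≤ ∑ _k : Fin m, ‖v‖ := Finset.sum_le_sum fun k _ => PiLp.norm_apply_le v k
    _ = m * ‖v‖ := by simp

lemma norm_le_vecL1 {m : ℕ} (v : EuclideanSpace ℝ (Fin m)) : ‖v‖ ≤ vecL1 v := by
  rw [EuclideanSpace.norm_eq, Real.sqrt_le_left (vecL1_nonneg v)]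
  exact Finset.sum_sq_le_sq_sum_of_nonneg fun k _ => norm_nonneg _

lemma invNorm_nonneg {m n : ℕ} (G : Matrix (Fin m) (Fin n) ℝ) : 0 ≤ invNorm G :=
  Real.iSup_nonneg fun _ => div_nonneg (vecL1_nonneg _) (vecL1_nonneg _)

lemma bddAbove_invNorm {m n : ℕ} (G : Matrix (Fin m) (Fin n) ℝ) :
    BddAbove (Set.range fun y : LinearMap.range (Matrix.toEuclideanLin G) =>
      vecL1 ((inducedEquiv G).symm y : EuclideanSpace ℝ (Fin n)) /
        vecL1 (y : EuclideanSpace ℝ (Fin m))) := by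
  let T := LinearMap.toContinuousLinearMap (inducedEquiv G).symm.toLinearMap
  refine ⟨n * ‖T‖, ?_⟩
  rintro _ ⟨y, rfl⟩
  refine div_le_of_le_mul₀ (vecL1_nonneg _) (by positivity) ?_
  calc _ ≤ n * ‖((inducedEquiv G).symm y : EuclideanSpace ℝ (Fin n))‖ :=
        vecL1_le_card_mul_norm _
    _ ≤ n * (‖T‖ * ‖y‖) := by gcongr; exact T.le_opNorm y
    _ ≤ n * (‖T‖ * vecL1 (y : EuclideanSpace ℝ (Fin m))) := by
        gcongr; exact norm_le_vecL1 (y : EuclideanSpace ℝ (Fin m))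
    _ = _ := by ring

lemma vecL1_symm_le {m n : ℕ} (G : Matrix (Fin m) (Fin n) ℝ)
    (y : LinearMap.range (Matrix.toEuclideanLin G)) :
    vecL1 ((inducedEquiv G).symm y : EuclideanSpace ℝ (Fin n)) ≤
      invNorm G * vecL1 (y : EuclideanSpace ℝ (Fin m)) := by
  rcases (vecL1_nonneg (y : EuclideanSpace ℝ (Fin m))).eq_or_lt with h | h
  · have hy : y = 0 := by
      have := norm_le_vecL1 (y : EuclideanSpace ℝ (Fin m))
      rw [← h] at this
      exact Subtype.ext (norm_le_zero_iff.1 this)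
    simp [hy, vecL1]
  · exact (div_le_iff₀ h).1 (le_ciSup (bddAbove_invNorm G) y)

lemma vecL1_le_invNorm_mul_add {m n : ℕ} (G : Matrix (Fin m) (Fin n) ℝ)
    (w : EuclideanSpace ℝ (Fin n)) :
    vecL1 w ≤ invNorm G * vecL1 (Matrix.toEuclideanLin G w) +
      vecL1 ((kernel G).starProjection w) := by
  let z : (kernel G)ᗮ :=
    ⟨w - (kernel G).starProjection w, (kernel G).sub_starProjection_mem_orthogonal w⟩
  have hker : Matrix.toEuclideanLin G ((kernel G).starProjection w) = 0 :=
    LinearMap.mem_ker.1 ((kernel G).starProjection_apply_mem w)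
  have hz : ((inducedEquiv G z : LinearMap.range (Matrix.toEuclideanLin G)) :
      EuclideanSpace ℝ (Fin m)) = Matrix.toEuclideanLin G w := by
    have : ((inducedEquiv G z : LinearMap.range (Matrix.toEuclideanLin G)) :
      EuclideanSpace ℝ (Fin m)) = Matrix.toEuclideanLin G (z : EuclideanSpace ℝ (Fin n)) := by
      rfl
    rw [this, map_sub, hker, sub_zero]
  have h := vecL1_symm_le G (inducedEquiv G z)
  rw [LinearEquiv.symm_apply_apply, hz] at h
  have h2 := vecL1_add_le (z : EuclideanSpace ℝ (Fin n)) ((kernel G).starProjection w)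
  rw [show (z : EuclideanSpace ℝ (Fin n)) + (kernel G).starProjection w = w from
    sub_add_cancel _ _] at h2
  linarith

lemma l1Norm_eq_sum_vecL1 {m n : ℕ} (W : Matrix (Fin m) (Fin n) ℝ) :
    l1Norm W = ∑ c, vecL1 (WithLp.toLp 2 fun i => W i c) :=
  Finset.sum_comm

lemma l1Norm_nonneg {m n : ℕ} (W : Matrix (Fin m) (Fin n) ℝ) : 0 ≤ l1Norm W :=
  Finset.sum_nonneg fun _ _ => Finset.sum_nonneg fun _ _ => abs_nonneg _

lemma l1Norm_le_invNorm_mul_add {m n q : ℕ} (G : Matrix (Fin m) (Fin n) ℝ)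
    (W : Matrix (Fin n) (Fin q) ℝ) :
    l1Norm W ≤ invNorm G * l1Norm (G * W) + l1Norm (projKer G W) := by
  rw [l1Norm_eq_sum_vecL1 W, l1Norm_eq_sum_vecL1 (G * W), l1Norm_eq_sum_vecL1 (projKer G W),
    Finset.mul_sum, ← Finset.sum_add_distrib]
  exact Finset.sum_le_sum fun c _ =>
    vecL1_le_invNorm_mul_add G (WithLp.toLp 2 fun i => W i c)

variable (A : Architecture L) {m : Fin (L + 1) → ℕ} (G : RegMatrices A m)

lemma constM_nonneg : 0 ≤ constM A G := Real.iSup_nonneg fun _ => invNorm_nonneg _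

lemma invNorm_le_constM (l : Fin (L + 1)) : invNorm (G l) ≤ constM A G :=
  le_ciSup (f := fun l => invNorm (G l)) (Set.finite_range _).bddAbove l

lemma sum_l1Norm_le_one {ν : ℝ} (hM : constM A G < 1) (hν : 1 / (1 - constM A G) ≤ ν)
    {Θ : Params A} (hΘ : Θ ∈ unitBall A G ν) : ∑ l, l1Norm (Θ l) ≤ 1 := by
  have h : reg A G ν Θ ≤ 1 := hΘ
  rw [reg] at h
  have hM0 := constM_nonneg A G
  have h1 : ∑ l, l1Norm (Θ l) ≤
      constM A G * ∑ l, l1Norm (G l * Θ l) + ∑ l, l1Norm (projKer (G l) (Θ l)) := by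
    rw [Finset.mul_sum, ← Finset.sum_add_distrib]
    refine Finset.sum_le_sum fun l _ => (l1Norm_le_invNorm_mul_add (G l) (Θ l)).trans ?_
    have := mul_le_mul_of_nonneg_right (invNorm_le_constM A G l) (l1Norm_nonneg (G l * Θ l))
    linarith
  have hν1 : 1 ≤ ν := le_trans (by rw [le_div_iff₀ (by linarith)]; linarith) hν
  have hG0 : 0 ≤ ∑ l, l1Norm (G l * Θ l) := Finset.sum_nonneg fun _ _ => l1Norm_nonneg _
  have hP0 : 0 ≤ ∑ l, l1Norm (projKer (G l) (Θ l)) :=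
    Finset.sum_nonneg fun _ _ => l1Norm_nonneg _
  nlinarith

end Regularizer

section Network

/-- The Frobenius norm of a matrix. -/
def frobNorm {m n : ℕ} (W : Matrix (Fin m) (Fin n) ℝ) : ℝ := √(∑ k, ∑ j, W k j ^ 2)

lemma frobNorm_nonneg {m n : ℕ} (W : Matrix (Fin m) (Fin n) ℝ) : 0 ≤ frobNorm W :=
  Real.sqrt_nonneg _

lemma norm_mulVec_le {m n : ℕ} (W : Matrix (Fin m) (Fin n) ℝ) (v : EuclideanSpace ℝ (Fin n)) :
    ‖WithLp.toLp 2 (W.mulVec v.ofLp)‖ ≤ frobNorm W * ‖v‖ := by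
  have h0 : 0 ≤ ∑ k, ∑ j, W k j ^ 2 :=
    Finset.sum_nonneg fun _ _ => Finset.sum_nonneg fun _ _ => sq_nonneg _
  rw [EuclideanSpace.norm_eq, EuclideanSpace.norm_eq, frobNorm, ← Real.sqrt_mul h0]
  refine Real.sqrt_le_sqrt ?_
  rw [Finset.sum_mul]
  refine Finset.sum_le_sum fun k _ => ?_
  simp only [Real.norm_eq_abs, sq_abs]
  exact Finset.sum_mul_sq_le_sq_mul_sq Finset.univ (fun j => W k j) fun j => v j

lemma frobNorm_le_l1Norm {m n : ℕ} (W : Matrix (Fin m) (Fin n) ℝ) : frobNorm W ≤ l1Norm W := by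
  rw [frobNorm, Real.sqrt_le_left (l1Norm_nonneg W)]
  calc ∑ k, ∑ j, W k j ^ 2 ≤ ∑ k, (∑ j, |W k j|) ^ 2 := by
        refine Finset.sum_le_sum fun k _ => ?_
        have h := Finset.sum_sq_le_sq_sum_of_nonneg (s := Finset.univ) (f := fun j => |W k j|)
          fun j _ => abs_nonneg _
        simpa only [sq_abs] using h
    _ ≤ l1Norm W ^ 2 :=
        Finset.sum_sq_le_sq_sum_of_nonneg fun k _ => Finset.sum_nonneg fun j _ => abs_nonneg _

variable {A : Architecture L} {f : Activations A} {a : ℝ}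

lemma IsAdmissible.norm_le (hf : IsAdmissible A f a) {l : ℕ} (h1 : 1 ≤ l) (hL : l ≤ L)
    (z : EuclideanSpace ℝ (Fin (A.p l))) : ‖f l z‖ ≤ a * ‖z‖ := by
  simpa [hf.map_zero l h1 hL] using hf.lipschitz l h1 hL z 0

lemma norm_layer_le (hf : IsAdmissible A f a) (ha : 0 ≤ a) {Θ : Params A}
    (hΘ : ∀ l, frobNorm (Θ l) ≤ 1) (x : EuclideanSpace ℝ (Fin (A.p 0))) (l : ℕ)
    (h : l < L + 1) : ‖layer A f Θ x l h‖ ≤ a ^ l * ‖x‖ := by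
  induction l with
  | zero =>
    rw [layer, pow_zero]
    exact (norm_mulVec_le (Θ ⟨0, h⟩) x).trans
      (mul_le_mul_of_nonneg_right (hΘ ⟨0, h⟩) (norm_nonneg x))
  | succ l ih =>
    rw [layer]
    refine (norm_mulVec_le (Θ ⟨l + 1, h⟩) _).trans ?_
    calc _ ≤ 1 * ‖f (l + 1) (layer A f Θ x l (Nat.lt_of_succ_lt h))‖ :=
          mul_le_mul_of_nonneg_right (hΘ ⟨l + 1, h⟩) (norm_nonneg _)
      _ ≤ a * ‖layer A f Θ x l (Nat.lt_of_succ_lt h)‖ := by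
          rw [one_mul]; exact hf.norm_le (by omega) (by omega) _
      _ ≤ a * (a ^ l * ‖x‖) := by gcongr; exact ih _
      _ = a ^ (l + 1) * ‖x‖ := by ring

lemma norm_layer_sub_le (hf : IsAdmissible A f a) (ha : 0 ≤ a) {Θ Γ : Params A}
    (hΘ : ∀ l, frobNorm (Θ l) ≤ 1) (hΓ : ∀ l, frobNorm (Γ l) ≤ 1) {D : ℝ}
    (hD : ∀ l, frobNorm (Θ l - Γ l) ≤ D) (x : EuclideanSpace ℝ (Fin (A.p 0))) (l : ℕ)
    (h : l < L + 1) :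
    ‖layer A f Θ x l h - layer A f Γ x l h‖ ≤ (l + 1) * D * (a ^ l * ‖x‖) := by
  induction l with
  | zero =>
    have : layer A f Θ x 0 h - layer A f Γ x 0 h =
        WithLp.toLp 2 ((Θ ⟨0, h⟩ - Γ ⟨0, h⟩).mulVec x.ofLp) := by
      rw [layer, layer, Matrix.sub_mulVec, WithLp.toLp_sub]
    rw [this]
    refine (norm_mulVec_le _ x).trans ?_
    have := mul_le_mul_of_nonneg_right (hD ⟨0, h⟩) (norm_nonneg x)
    simpa using this
  | succ l ih =>
    have h' := Nat.lt_of_succ_lt h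
    set z := f (l + 1) (layer A f Θ x l h') with hz
    set w := f (l + 1) (layer A f Γ x l h') with hw
    have : layer A f Θ x (l + 1) h - layer A f Γ x (l + 1) h =
        WithLp.toLp 2 ((Θ ⟨l + 1, h⟩ - Γ ⟨l + 1, h⟩).mulVec z.ofLp) +
        WithLp.toLp 2 ((Γ ⟨l + 1, h⟩).mulVec (z - w).ofLp) := by
      rw [layer, layer, Matrix.sub_mulVec, WithLp.ofLp_sub, Matrix.mulVec_sub, WithLp.toLp_sub,
        WithLp.toLp_sub, sub_add_sub_cancel]
    rw [this]
    have hzn : ‖z‖ ≤ a * (a ^ l * ‖x‖) :=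
      (hf.norm_le (by omega) (by omega) _).trans
        (mul_le_mul_of_nonneg_left (norm_layer_le hf ha hΘ x l h') ha)
    have hzw : ‖z - w‖ ≤ a * ((l + 1) * D * (a ^ l * ‖x‖)) :=
      (hf.lipschitz (l + 1) (by omega) (by omega) _ _).trans
        (mul_le_mul_of_nonneg_left (ih h') ha)
    have hD0 : 0 ≤ D := (frobNorm_nonneg _).trans (hD ⟨0, by omega⟩)
    calc _ ≤ _ := norm_add_le _ _
      _ ≤ frobNorm (Θ ⟨l + 1, h⟩ - Γ ⟨l + 1, h⟩) * ‖z‖ + frobNorm (Γ ⟨l + 1, h⟩) * ‖z - w‖ :=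
          add_le_add (norm_mulVec_le _ z) (norm_mulVec_le (Γ ⟨l + 1, h⟩) (z - w))
      _ ≤ D * (a * (a ^ l * ‖x‖)) + 1 * (a * ((l + 1) * D * (a ^ l * ‖x‖))) :=
          add_le_add
            (mul_le_mul (hD ⟨l + 1, h⟩) hzn (norm_nonneg _) hD0)
            (mul_le_mul (hΓ ⟨l + 1, h⟩) hzw (norm_nonneg _) zero_le_one)
      _ = _ := by push_cast; ring

lemma abs_network_sub_le (hf : IsAdmissible A f a) (ha : 0 ≤ a) {Θ Γ : Params A}
    (hΘ : ∀ l, frobNorm (Θ l) ≤ 1) (hΓ : ∀ l, frobNorm (Γ l) ≤ 1) {D : ℝ}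
    (hD : ∀ l, frobNorm (Θ l - Γ l) ≤ D) (x : EuclideanSpace ℝ (Fin (A.p 0))) :
    |network A f Θ x - network A f Γ x| ≤ (L + 1) * D * (a ^ L * ‖x‖) :=
  le_trans (PiLp.norm_apply_le (layer A f Θ x L (Nat.lt_succ_self L) -
    layer A f Γ x L (Nat.lt_succ_self L)) _) (norm_layer_sub_le hf ha hΘ hΓ hD x L _)

lemma abs_network_le (hf : IsAdmissible A f a) (ha : 0 ≤ a) {Θ : Params A}
    (hΘ : ∀ l, frobNorm (Θ l) ≤ 1) (x : EuclideanSpace ℝ (Fin (A.p 0))) :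
    |network A f Θ x| ≤ a ^ L * ‖x‖ :=
  le_trans (PiLp.norm_apply_le (layer A f Θ x L (Nat.lt_succ_self L)) _)
    (norm_layer_le hf ha hΘ x L _)

lemma network_zero_params (x : EuclideanSpace ℝ (Fin (A.p 0))) : network A f 0 x = 0 := by
  have : ∀ (l : ℕ) (h : l < L + 1), layer A f 0 x l h = 0 := by
    intro l h
    cases l <;> rw [layer] <;> simp
  rw [network, this]
  rfl

/-- The coordinates of the parameter space. -/
abbrev ParamIndex (A : Architecture L) : Type :=
  (l : Fin (L + 1)) × (Fin (A.p (l + 1)) × Fin (A.p l))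

/-- The parameter tuple with given coordinates. -/
def toParams (A : Architecture L) (θ : ParamIndex A → ℝ) : Params A :=
  fun l => Matrix.of fun k j => θ ⟨l, k, j⟩

lemma card_paramIndex (A : Architecture L) : Fintype.card (ParamIndex A) = numParams A := by
  simp [numParams]

lemma sum_paramIndex (F : ParamIndex A → ℝ) :
    ∑ k, F k = ∑ l, ∑ k, ∑ j, F ⟨l, k, j⟩ := by
  simp only [Fintype.sum_sigma, Fintype.sum_prod_type]

lemma frobNorm_toParams_le_one {θ : ParamIndex A → ℝ} (hθ : ∑ k, |θ k| ≤ 1)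
    (l : Fin (L + 1)) : frobNorm (toParams A θ l) ≤ 1 := by
  refine (frobNorm_le_l1Norm _).trans (le_trans ?_ hθ)
  rw [sum_paramIndex]
  exact Finset.single_le_sum (f := fun l => l1Norm (toParams A θ l))
    (fun _ _ => l1Norm_nonneg _) (Finset.mem_univ l)

lemma frobNorm_toParams_sub_le (θ θ' : ParamIndex A → ℝ) (l : Fin (L + 1)) :
    frobNorm (toParams A θ l - toParams A θ' l) ≤ √(∑ k, (θ k - θ' k) ^ 2) := by
  refine Real.sqrt_le_sqrt ?_
  rw [sum_paramIndex]
  exact Finset.single_le_sum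
    (f := fun l => ∑ k, ∑ j, (toParams A θ l - toParams A θ' l) k j ^ 2)
    (fun _ _ => Finset.sum_nonneg fun _ _ => Finset.sum_nonneg fun _ _ => sq_nonneg _)
    (Finset.mem_univ l)

lemma IsAdmissible.continuous (hf : IsAdmissible A f a) (ha : 0 ≤ a) {l : ℕ} (h1 : 1 ≤ l)
    (hL : l ≤ L) : Continuous (f l) :=
  (LipschitzWith.of_dist_le_mul (K := Real.toNNReal a) fun z z' => by
    simpa [dist_eq_norm, Real.coe_toNNReal a ha] using hf.lipschitz l h1 hL z z').continuous

lemma continuous_layer (hf : IsAdmissible A f a) (ha : 0 ≤ a)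
    (x : EuclideanSpace ℝ (Fin (A.p 0))) (l : ℕ) (h : l < L + 1) :
    Continuous fun θ => layer A f (toParams A θ) x l h := by
  have hW : ∀ l, Continuous fun θ : ParamIndex A → ℝ => toParams A θ l := fun l =>
    continuous_matrix fun k j => continuous_apply _
  induction l with
  | zero =>
    simp only [layer]
    exact (PiLp.continuous_toLp 2 _).comp ((hW ⟨0, h⟩).matrix_mulVec continuous_const)
  | succ l ih =>
    simp only [layer]
    exact (PiLp.continuous_toLp 2 _).comp ((hW ⟨l + 1, h⟩).matrix_mulVec
      ((PiLp.continuous_ofLp 2 _).comp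
        ((hf.continuous ha (by omega) (by omega)).comp (ih _))))

lemma continuous_network (hf : IsAdmissible A f a) (ha : 0 ≤ a)
    (x : EuclideanSpace ℝ (Fin (A.p 0))) :
    Continuous fun θ => network A f (toParams A θ) x :=
  (continuous_apply _).comp
    ((PiLp.continuous_ofLp 2 _).comp (continuous_layer hf ha x L (Nat.lt_succ_self L)))

end Network

variable {A : Architecture L} {f : Activations A} {a : ℝ}

lemma sum_norm_sq_eq {d n : ℕ} (hn : 0 < n) (x : Fin n → EuclideanSpace ℝ (Fin d)) :
    ∑ i, ‖x i‖ ^ 2 = n * empNorm x ^ 2 := by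
  have hn' : (n : ℝ) ≠ 0 := by positivity
  rw [empNorm, Real.sq_sqrt (Finset.sum_nonneg fun _ _ => by positivity), ← Finset.sum_div]
  field_simp

lemma exists_coordinates {Θ : Params A} (hΘ : ∑ l, l1Norm (Θ l) ≤ 1) :
    ∃ θ : ParamIndex A → ℝ, toParams A θ = Θ ∧ ∑ k, |θ k| ≤ 1 := by
  refine ⟨fun k => Θ k.1 k.2.1 k.2.2, rfl, ?_⟩
  rw [sum_paramIndex]
  exact hΘ

/-- A bound for the empirical process of the noise, uniform over the `ℓ¹` ball of parameters. -/
lemma exists_event_forall_abs_noise_le {Ω : Type*} [MeasurableSpace Ω] {μ : Measure Ω}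
    [IsProbabilityMeasure μ] {n : ℕ} (hn : 0 < n) {u : Fin n → Ω → ℝ} {K γ : ℝ} (hK : 0 < K)
    (hu : IsSubGaussianNoise μ u K γ) (hf : IsAdmissible A f a) (ha : 0 ≤ a)
    (hP : 0 < numParams A) (x : Fin n → EuclideanSpace ℝ (Fin (A.p 0)))
    {Λ : ℝ} (hΛ : 0 < Λ) :
    ∃ E : Set Ω, MeasurableSet E ∧ 1 - 1 / (n : ℝ) ≤ μ.real E ∧
      ∀ ω ∈ E, ∀ Θ : Params A, ∑ l, l1Norm (Θ l) ≤ 1 →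
        |∑ i, network A f Θ (x i) * u i ω| ≤
          (K ^ 2 + 2 * γ ^ 2) * (((L + 1) * a ^ L) ^ 2 * (n * empNorm x ^ 2)) * Λ / 2 +
            (2 * Real.log (2 * numParams A) + 8 + 2 * Real.log (2 * n)) / Λ := by
  have hne : Nonempty (ParamIndex A) := by
    rw [← Fintype.card_pos_iff, card_paramIndex]
    exact hP
  have hn1 : (1 : ℝ) ≤ n := by exact_mod_cast hn
  obtain ⟨E, hEm, hE, h⟩ := exists_event_forall_abs_le (μ := μ) (ι := ParamIndex A)
    (X := fun θ ω => ∑ i, network A f (toParams A θ) (x i) * u i ω)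
    (fun θ => Finset.measurable_fun_sum _ fun i _ => (hu.measurable i).const_mul _)
    (fun ω => by
      have : toParams A (0 : ParamIndex A → ℝ) = 0 := rfl
      simp [this, network_zero_params])
    (fun ω => (continuous_finsetSum _ fun i _ =>
      (continuous_network hf ha (x i)).mul continuous_const).continuousOn)
    (v := (K ^ 2 + 2 * γ ^ 2) * (((L + 1) * a ^ L) ^ 2 * (n * empNorm x ^ 2)))
    (by positivity)
    (fun θ θ' hθ hθ' => by
      have hnet : ∀ i, (network A f (toParams A θ) (x i) - network A f (toParams A θ') (x i)) ^ 2 ≤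
          ((L + 1) * a ^ L) ^ 2 * (∑ k, (θ k - θ' k) ^ 2) * ‖x i‖ ^ 2 := by
        intro i
        have h1 := abs_network_sub_le hf ha (frobNorm_toParams_le_one hθ)
          (frobNorm_toParams_le_one hθ') (frobNorm_toParams_sub_le θ θ') (x i)
        have h2 := pow_le_pow_left₀ (abs_nonneg _) h1 2
        rw [sq_abs] at h2
        refine h2.trans_eq ?_
        rw [mul_pow, mul_pow, Real.sq_sqrt (Finset.sum_nonneg fun _ _ => sq_nonneg _)]
        ring
      have hsum : ∑ i, (network A f (toParams A θ) (x i) - network A f (toParams A θ') (x i)) ^ 2 ≤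
          ((L + 1) * a ^ L) ^ 2 * (n * empNorm x ^ 2) * ∑ k, (θ k - θ' k) ^ 2 := by
        refine (Finset.sum_le_sum fun i _ => hnet i).trans_eq ?_
        rw [← Finset.mul_sum, sum_norm_sq_eq hn]
        ring
      have := hu.hasSubgaussianMGF_sum hK _ hsum
      rw [← mul_assoc] at this
      simpa only [sub_mul, Finset.sum_sub_distrib] using this)
    hΛ (δ := 1 / n) (by positivity) (by rw [div_le_one (by positivity)]; exact hn1)
  refine ⟨E, hEm, hE, fun ω hω Θ hΘ => ?_⟩
  obtain ⟨θ, rfl, hθ⟩ := exists_coordinates hΘ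
  have := h ω hω θ hθ
  rw [card_paramIndex, div_div_eq_mul_div, div_one] at this
  exact this

/-- The basic inequality: if the penalty dominates the effective noise, every estimator satisfies
the oracle inequality. -/
lemma IsEstimator.sq_err_le {m : Fin (L + 1) → ℕ} {G : RegMatrices A m} {ν lam : ℝ} {n : ℕ}
    {x : Fin n → EuclideanSpace ℝ (Fin (A.p 0))} {g : EuclideanSpace ℝ (Fin (A.p 0)) → ℝ}
    {u : Fin n → ℝ}
    (hnoise : ∀ Θ ∈ unitBall A G ν, 2 / n * |∑ i, network A f Θ (x i) * u i| ≤ lam)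
    {q : ℝ × Params A} (hq : IsEstimator A f G ν x (fun i => g (x i) + u i) lam q) :
    err A f x g q.1 q.2 ^ 2 ≤
      sInf ((fun q' : ℝ × Params A => err A f x g q'.1 q'.2 ^ 2 + 2 * lam * q'.1) ''
        (Set.Ici (0 : ℝ) ×ˢ unitBall A G ν)) := by
  have herr : ∀ κ Θ, err A f x g κ Θ ^ 2 =
      1 / n * ∑ i, (g (x i) - κ * network A f Θ (x i)) ^ 2 := fun κ Θ =>
    Real.sq_sqrt (mul_nonneg (by positivity) (Finset.sum_nonneg fun _ _ => sq_nonneg _))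
  have hobj : ∀ q : ℝ × Params A, objective A f x (fun i => g (x i) + u i) lam q =
      err A f x g q.1 q.2 ^ 2 + 1 / n * ∑ i, (2 * g (x i) * u i + u i ^ 2) -
        q.1 * (2 / n * ∑ i, network A f q.2 (x i) * u i) + lam * q.1 := by
    intro q
    rw [herr, objective]
    have : ∑ i, (g (x i) + u i - q.1 * network A f q.2 (x i)) ^ 2 =
        ∑ i, (g (x i) - q.1 * network A f q.2 (x i)) ^ 2 + ∑ i, (2 * g (x i) * u i + u i ^ 2) -
          2 * q.1 * ∑ i, network A f q.2 (x i) * u i := by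
      rw [Finset.mul_sum, ← Finset.sum_add_distrib, ← Finset.sum_sub_distrib]
      exact Finset.sum_congr rfl fun i _ => by ring
    rw [this]
    ring
  have hbound : ∀ q : ℝ × Params A, q ∈ Set.Ici (0 : ℝ) ×ˢ unitBall A G ν →
      |q.1 * (2 / n * ∑ i, network A f q.2 (x i) * u i)| ≤ lam * q.1 := by
    rintro q ⟨hq1, hq2⟩
    have hn : (0 : ℝ) ≤ 2 / n := by positivity
    rw [abs_mul, abs_mul, abs_of_nonneg (Set.mem_Ici.1 hq1), abs_of_nonneg hn, mul_comm lam]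
    exact mul_le_mul_of_nonneg_left (hnoise _ hq2) hq1
  refine le_csInf (Set.Nonempty.image _ ⟨q, hq.1⟩) ?_
  rintro _ ⟨q', hq', rfl⟩
  have h := isMinOn_iff.1 hq.2 q' hq'
  rw [hobj, hobj] at h
  have h1 := (abs_le.1 (hbound q hq.1)).2
  have h2 := (abs_le.1 (hbound q' hq')).1
  simp only
  linarith

lemma network_eq_zero_of_degenerate (hf : IsAdmissible A f a) (ha : 0 ≤ a) (hL : 1 ≤ L)
    (h : a = 0 ∨ numParams A = 0) {Θ : Params A} (hΘ : ∑ l, l1Norm (Θ l) ≤ 1)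
    (x : EuclideanSpace ℝ (Fin (A.p 0))) : network A f Θ x = 0 := by
  obtain ⟨θ, rfl, hθ⟩ := exists_coordinates hΘ
  rcases h with rfl | h
  · have := abs_network_le hf ha (frobNorm_toParams_le_one hθ) x
    rw [zero_pow (by omega), zero_mul] at this
    exact abs_nonpos_iff.1 this
  · rw [← card_paramIndex, Fintype.card_eq_zero_iff] at h
    have : θ = 0 := Subsingleton.elim _ _
    rw [this]
    exact network_zero_params x

/-- Optimization of the free parameter in `exists_event_forall_abs_noise_le`. -/
lemma noise_bound_le {c X n ℓ w κ : ℝ} (hX : 0 < X) (hn : 0 < n)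
    (hℓ : 1 / 2 ≤ ℓ) (hw : 1 ≤ w) (hκ : c + 44 ≤ κ * √w) :
    2 / n * (c * (n * X ^ 2) * (√ℓ * √w / (√n * X)) / 2 +
      (2 * ℓ + 8 + 2 * w) / (√ℓ * √w / (√n * X))) ≤ κ * X * √ℓ * (w / √n) := by
  have hℓ0 : 0 < ℓ := by linarith
  have hw0 : 0 < w := by linarith
  obtain ⟨s, hs, hsn⟩ : ∃ s : ℝ, 0 < s ∧ n = s ^ 2 := ⟨√n, by positivity, (Real.sq_sqrt hn.le).symm⟩
  obtain ⟨p, hp, hpℓ⟩ : ∃ p : ℝ, 0 < p ∧ ℓ = p ^ 2 := ⟨√ℓ, by positivity, (Real.sq_sqrt hℓ0.le).symm⟩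
  obtain ⟨t, ht, htw⟩ : ∃ t : ℝ, 0 < t ∧ w = t ^ 2 := ⟨√w, by positivity, (Real.sq_sqrt hw0.le).symm⟩
  subst hsn hpℓ htw
  rw [Real.sqrt_sq hs.le, Real.sqrt_sq hp.le, Real.sqrt_sq ht.le]
  rw [Real.sqrt_sq ht.le] at hκ
  have h1 : 2 * p ^ 2 + 8 + 2 * t ^ 2 ≤ 22 * (p ^ 2 * t ^ 2) := by
    nlinarith [mul_nonneg (sub_nonneg.2 hℓ) (sub_nonneg.2 hw)]
  calc 2 / s ^ 2 * (c * (s ^ 2 * X ^ 2) * (p * t / (s * X)) / 2 +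
        (2 * p ^ 2 + 8 + 2 * t ^ 2) / (p * t / (s * X)))
      ≤ 2 / s ^ 2 * (c * (s ^ 2 * X ^ 2) * (p * t / (s * X)) / 2 +
        22 * (p ^ 2 * t ^ 2) / (p * t / (s * X))) := by gcongr
    _ = (c + 44) * (X * p * t / s) := by field_simp; ring
    _ ≤ κ * t * (X * p * t / s) := by gcongr
    _ = κ * X * p * (t ^ 2 / s) := by ring

lemma exists_forall_le_mul_sqrt_log (c : ℝ) {κ : ℝ} (hκ : 0 < κ) :
    ∃ N : ℕ, ∀ n : ℕ, N ≤ n →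
      0 < n ∧ 1 ≤ Real.log (2 * n) ∧ c ≤ κ * √(Real.log (2 * n)) := by
  refine ⟨⌈Real.exp ((c / κ) ^ 2)⌉₊ + 2, fun n hn => ?_⟩
  have h2 : (2 : ℝ) ≤ n := by exact_mod_cast (by omega : 2 ≤ n)
  have hexp : Real.exp ((c / κ) ^ 2) ≤ 2 * n := by
    have h : (⌈Real.exp ((c / κ) ^ 2)⌉₊ : ℝ) ≤ n := by
      exact_mod_cast (by omega : ⌈Real.exp ((c / κ) ^ 2)⌉₊ ≤ n)
    linarith [Nat.le_ceil (Real.exp ((c / κ) ^ 2))]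
  refine ⟨by omega, ?_, ?_⟩
  · rw [Real.le_log_iff_exp_le (by linarith)]
    linarith [Real.exp_one_lt_d9]
  · have h : c / κ ≤ √(Real.log (2 * n)) :=
      Real.le_sqrt_of_sq_le ((Real.le_log_iff_exp_le (by linarith)).2 hexp)
    rw [div_le_iff₀ hκ] at h
    linarith

end DeepNet

end

open DeepNet in
/-- Oracle inequality for the regularized network estimator. The constant `C` depends on the noise
parameters only; the threshold `N` for the sample size depends only on these, the depth `L`, the
Lipschitz constant `a` and a positive lower bound `r` of `‖x‖_n`. -/
theorem mainTheorem1 (K γ : ℝ) (hK : 0 < K) (hγ : 0 < γ) :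
    ∃ C : ℝ, 0 < C ∧
      ∀ (L : ℕ) (a r : ℝ), 1 ≤ L → 0 ≤ a → 0 < r →
      ∃ N : ℕ, ∀ n : ℕ, N ≤ n →
      ∀ (A : Architecture L) (f : Activations A) (m : Fin (L + 1) → ℕ) (G : RegMatrices A m)
        (ν lam : ℝ) (x : Fin n → EuclideanSpace ℝ (Fin (A.p 0)))
        (g : EuclideanSpace ℝ (Fin (A.p 0)) → ℝ)
        (Ω : Type*) [MeasurableSpace Ω] (μ : Measure Ω) [IsProbabilityMeasure μ]
        (u : Fin n → Ω → ℝ),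
        IsAdmissible A f a →
        constM A G < 1 →
        1 / (1 - constM A G) ≤ ν →
        r ≤ empNorm x →
        IsSubGaussianNoise μ u K γ →
        C * (constM A G + 1) * a ^ (2 * L) * empNorm x ^ 2 * (√2 / L) ^ (2 * L - 1)
            * √(Real.log (2 * numParams A)) * (Real.log (2 * n) / √n) ≤ lam →
        ∃ E : Set Ω, MeasurableSet E ∧ 1 - 1 / (n : ℝ) ≤ μ.real E ∧
          ∀ ω ∈ E, ∀ q : ℝ × Params A,
            IsEstimator A f G ν x (fun i => g (x i) + u i ω) lam q →
            err A f x g q.1 q.2 ^ 2 ≤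
              sInf ((fun q' : ℝ × Params A => err A f x g q'.1 q'.2 ^ 2 + 2 * lam * q'.1) ''
                (Set.Ici (0 : ℝ) ×ˢ unitBall A G ν)) := by
  -- The uniform noise bound is smaller than the penalty by a factor of order `√(log n)`, so that
  -- the threshold `N` absorbs all constants and `C = 1` suffices.
  refine ⟨1, one_pos, fun L a r hL ha hr => ?_⟩
  set ρ : ℝ := (√2 / L) ^ (2 * L - 1) with hρ
  have hρ0 : 0 < ρ := by
    have : (0 : ℝ) < L := by exact_mod_cast hL
    positivity
  set c : ℝ := (K ^ 2 + 2 * γ ^ 2) * ((L + 1) * a ^ L) ^ 2 with hc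
  obtain ⟨N, hN⟩ : ∃ N : ℕ, ∀ n : ℕ, N ≤ n → 0 < n ∧ 1 ≤ Real.log (2 * n) ∧
      (0 < a → c + 44 ≤ a ^ (2 * L) * r * ρ * √(Real.log (2 * n))) := by
    rcases ha.eq_or_lt with h0 | h0
    · obtain ⟨N, hN⟩ := exists_forall_le_mul_sqrt_log 0 one_pos
      exact ⟨N, fun n hn => ⟨(hN n hn).1, (hN n hn).2.1, fun h => absurd h0 h.ne⟩⟩
    · obtain ⟨N, hN⟩ := exists_forall_le_mul_sqrt_log (c + 44)
        (κ := a ^ (2 * L) * r * ρ) (by positivity)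
      exact ⟨N, fun n hn => ⟨(hN n hn).1, (hN n hn).2.1, fun _ => (hN n hn).2.2⟩⟩
  refine ⟨N, fun n hn A f m G ν lam x g Ω _ μ _ u hf hM hν hx hu hlam => ?_⟩
  obtain ⟨hn0, hlog, hκ⟩ := hN n hn
  have hn' : (0 : ℝ) < n := by exact_mod_cast hn0
  have hX : 0 < empNorm x := hr.trans_le hx
  have hM0 := constM_nonneg A G
  by_cases hdeg : a = 0 ∨ numParams A = 0
  · refine ⟨Set.univ, MeasurableSet.univ, by simp, fun ω _ q hq => hq.sq_err_le fun Θ hΘ => ?_⟩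
    have hzero : ∀ i, network A f Θ (x i) = 0 := fun i =>
      network_eq_zero_of_degenerate hf ha hL hdeg (sum_l1Norm_le_one A G hM hν hΘ) _
    simp only [hzero, zero_mul, Finset.sum_const_zero, abs_zero, mul_zero]
    refine le_trans ?_ hlam
    have : 0 ≤ Real.log (2 * n) := by linarith
    positivity
  · push Not at hdeg
    have ha0 : 0 < a := lt_of_le_of_ne ha hdeg.1.symm
    have hP : 0 < numParams A := Nat.pos_of_ne_zero hdeg.2
    have hP1 : (1 : ℝ) ≤ numParams A := by exact_mod_cast hP
    set ℓ := Real.log (2 * numParams A) with hℓ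
    set w := Real.log (2 * n) with hw
    have hℓ2 : 1 / 2 ≤ ℓ := by
      have : Real.log 2 ≤ ℓ := Real.log_le_log (by norm_num) (by linarith)
      linarith [Real.log_two_gt_d9]
    have hℓ0 : 0 < ℓ := by linarith
    have hw0 : 0 < w := by linarith
    obtain ⟨E, hEm, hE, h⟩ := exists_event_forall_abs_noise_le hn0 hK hu hf ha hP x
      (Λ := √ℓ * √w / (√n * empNorm x)) (by positivity)
    refine ⟨E, hEm, hE, fun ω hω q hq => hq.sq_err_le fun Θ hΘ => le_trans ?_ hlam⟩
    have h1 := h ω hω Θ (sum_l1Norm_le_one A G hM hν hΘ)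
    rw [← mul_assoc, ← hc] at h1
    calc _ ≤ 2 / (n : ℝ) * _ := mul_le_mul_of_nonneg_left h1 (by positivity)
      _ ≤ a ^ (2 * L) * r * ρ * empNorm x * √ℓ * (w / √n) :=
          noise_bound_le hX hn' hℓ2 hlog (hκ ha0)
      _ ≤ a ^ (2 * L) * empNorm x * ρ * empNorm x * √ℓ * (w / √n) := by gcongr
      _ = 1 * (a ^ (2 * L) * empNorm x ^ 2 * ρ * √ℓ * (w / √n)) := by ring
      _ ≤ (constM A G + 1) * (a ^ (2 * L) * empNorm x ^ 2 * ρ * √ℓ * (w / √n)) := by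
          gcongr
          linarith
      _ = _ := by ring
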